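/- **Theorem (PAC-Bayes-split-kl inequality).** Let $\mathcal H$ and $\mathcal Z$ be measurable spaces, $K\ge 1$, $b_0<b_1<\dots<b_K$ real numbers, and $f:\mathcal H\times\mathcal Z\to\{b_0,\dots,b_K\}$ a (jointly measurable) loss function. For $j\in\{1,\dots,K\}$ put $\alpha_j=b_j-b_{j-1}$ and $f_j(h,z)=\mathbb 1[f(h,z)\ge b_j]$. Then $f=b_0+\sum_{j=1}^K\alpha_j f_j$. Let $n\ge 1$, let $S=(Z_1,\dots,Z_n)$ be an i.i.d. sample from a distribution $\mathcal D_Z$ on $\mathcal Z$, and put $$F(h)=\mathbb E_{Z\sim\mathcal D_Z}[f(h,Z)],\qquad \hat F_j(h,S)=\frac1n\sum_{i=1}^n f_j(h,Z_i).$$ For $p,q\in[0,1]$ let $\mathrm{kl}(p\|q)\in[0,\infty]$ be the Kullback–Leibler divergence between the Bernoulli distributions with biases $p$ and $q$, and for $\varepsilon\in[0,\infty]$ let $\mathrm{kl}^{-1,+}(\hat p,\varepsilon)=\max\{p\in[0,1]:\mathrm{kl}(\hat p\|p)\le\varepsilon\}$. Let $\pi$ be a probability distribution on $\mathcal H$ that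 is independent of $S$ (it may be fixed, or random and independent of $S$), and let $\delta\in(0,1)$. For a probability distribution $\rho$ on $\mathcal H$ let $$B(\rho,S)=b_0+\sum_{j=1}^K\alpha_j\,\mathrm{kl}^{-1,+}\!\left(\mathbb E_{h\sim\rho}[\hat F_j(h,S)],\ \frac{\mathrm{KL}(\rho\|\pi)+\ln\frac{2K\sqrt n}{\delta}}{n}\right).$$ Then, with probability at least $1-\delta$, simultaneously for all probability distributions $\rho$ on $\mathcal H$ (including those that depend on $S$), $$\mathbb E_{h\sim\rho}[F(h)]<B(\rho,S)\quad\text{or}\quad \mathbb E_{h\sim\rho}[F(h)]=B(\rho,S)=b_K .$$ In particular $\mathbb E_{h\sim\rho}[F(h)]\le B(\rho,S)$ for all $\rho$, and the inequality is strict for every $\rho$ with $\mathbb E_{h\sim\rho}[F(h)]<b_K$. Precisely, the outer probability of the event that some $\rho$ violates the displayed alternative is at most $\delta$. -/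

import Mathlib

open MeasureTheory ProbabilityTheory
open scoped ENNReal

noncomputable section

namespace SplitKL

/-- The binary Kullback-Leibler divergence `kl(p‖q) = KL((1-p, p) ‖ (1-q, q))` between the Bernoulli
distributions with biases `p, q ∈ [0,1]`, with values in `[0,∞]`. It is used only for `p, q ∈ [0,1]`,
where the projection onto `[0,1]` does nothing. -/
def binKL (p q : ℝ) : ℝ≥0∞ :=
  InformationTheory.klDiv
    (bernoulliMeasure true false (Set.projIcc 0 1 zero_le_one p))
    (bernoulliMeasure true false (Set.projIcc 0 1 zero_le_one q))

/-- The upper inverse `kl^{-1,+}(phat, ε) = max {p ∈ [0,1] | kl(phat‖p) ≤ ε}`. The set is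
bounded, contains `phat` when `phat ∈ [0,1]`, and is closed, so that its supremum is its maximum. -/
def klInvUpper (phat : ℝ) (ε : ℝ≥0∞) : ℝ :=
  sSup {p : ℝ | p ∈ Set.Icc (0 : ℝ) 1 ∧ binKL phat p ≤ ε}

variable {H 𝒵 : Type*} {K n : ℕ}

/-- The width `α_j = b_j - b_{j-1}`; the index `j : Fin K` stands for the `j + 1` of the range
`1, …, K`. -/
def width (b : Fin (K + 1) → ℝ) (j : Fin K) : ℝ := b j.succ - b j.castSucc

/-- The binary component `f_j(h, z) = 1[f(h, z) ≥ b_j]` (same indexing as in `width`). -/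
def component (b : Fin (K + 1) → ℝ) (f : H → 𝒵 → ℝ) (j : Fin K) (h : H) (z : 𝒵) : ℝ :=
  if b j.succ ≤ f h z then 1 else 0

/-- The expected loss `F(h) = E_{z ∼ D}[f(h, z)]`. -/
def expectedLoss [MeasurableSpace 𝒵] (D : Measure 𝒵) (f : H → 𝒵 → ℝ) (h : H) : ℝ :=
  ∫ z, f h z ∂D

/-- The empirical loss `(1/n) ∑ i, g(h, s i)` of `h` on the sample `s`. -/
def empiricalLoss (g : H → 𝒵 → ℝ) (s : Fin n → 𝒵) (h : H) : ℝ :=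
  (1 / (n : ℝ)) * ∑ i, g h (s i)

/-- The PAC-Bayes-split-kl bound
`b_0 + ∑ j, α_j kl^{-1,+}(E_ρ[Fhat_j(h, s)], (KL(ρ‖π) + ln (2 K √n / δ)) / n)`. -/
def splitKLBound [MeasurableSpace H] (b : Fin (K + 1) → ℝ) (f : H → 𝒵 → ℝ) (δ : ℝ)
    (π ρ : Measure H) (s : Fin n → 𝒵) : ℝ :=
  b 0 + ∑ j : Fin K, width b j *
    klInvUpper (∫ h, empiricalLoss (component b f j) s h ∂ρ)
      ((InformationTheory.klDiv ρ π
        + ENNReal.ofReal (Real.log (2 * (K : ℝ) * Real.sqrt n / δ))) / (n : ℝ≥0∞))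

end SplitKL

end

/-!
The failure event is covered by `K` events, one for each binary loss `1[f ≥ b_j]`, each of
probability at most `δ / K`.

*Exponential moment.* For a binary loss with bias `y` and `k` ones among `n` points,
`exp (n kl(k/n‖y))` is the ratio of the maximum likelihood of the sample to its likelihood under `y`
(`expKL`). Its expectation over an i.i.d. sample is therefore at most the sum over `k` of
`n.choose k * (k/n)^k * (1 - k/n)^(n-k)`, whatever `y` is (`lintegral_expKL_hits_le`). This sum is at
most `2 √n` for every `n ≥ 1`, with no exception for small `n`: the Krichevsky–Trofimov mixture
assigns to every binary word at least `1 / (2 √n)` times its maximum likelihood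
(`pow_mul_pow_le_ktWeight`), and its probabilities sum to one. As the prior is independent of the
sample, averaging over the prior preserves the bound (`lintegral_lintegral_expKL_le`), and Markov's
inequality bounds the probability that the average reaches `2 K √n / δ`.

*Change of measure.* Off that event, for all posteriors `ρ` at once, the Donsker–Varadhan inequality
and the joint convexity of `kl` give a strict bound on `kl` at the `ρ`-averages
(`mul_bernKL_le_klDiv_add_log`). Both are applied together: Donsker–Varadhan is used for the tangent
plane of `kl` at the averages, which is bounded even though `kl` is not. By continuity, the strict
bound puts the averaged bias strictly below the upper inverse, unless both equal `1`
(`integral_lt_klInvUpper`).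

*Splitting.* If the averaged loss reaches the bound, no component is strictly below its upper
inverse, hence all biases and all upper inverses are `1`, and both sides are `b_K`
(`integral_expectedLoss_lt_or_eq`).
-/

/-! ### The Krichevsky–Trofimov mixture and the Shtarkov sum -/

noncomputable section

namespace SplitKL

/-- The Krichevsky–Trofimov probability of a given binary word with `a` ones and `b` zeros: the
mixture of the Bernoulli probabilities `y ^ a * (1 - y) ^ b` over the Beta(1/2, 1/2) prior on `y`,
in closed form. -/
def ktWeight (a b : ℕ) : ℝ :=
  (∏ i ∈ Finset.range a, ((i : ℝ) + 1 / 2)) * (∏ i ∈ Finset.range b, ((i : ℝ) + 1 / 2))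
    / ((a + b).factorial : ℝ)

lemma ktWeight_nonneg (a b : ℕ) : 0 ≤ ktWeight a b := by
  unfold ktWeight
  positivity

lemma ktWeight_comm (a b : ℕ) : ktWeight a b = ktWeight b a := by
  unfold ktWeight
  rw [add_comm a b, mul_comm]

lemma ktWeight_succ_left (a b : ℕ) :
    ktWeight (a + 1) b = ktWeight a b * ((a + 1 / 2) / ((a + b : ℕ) + 1)) := by
  unfold ktWeight
  rw [Finset.prod_range_succ, show a + 1 + b = a + b + 1 by ring, Nat.factorial_succ]
  push_cast
  rw [mul_right_comm, div_mul_div_comm, mul_comm ((((a + b).factorial : ℕ) : ℝ))]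

lemma ktWeight_succ_right (a b : ℕ) :
    ktWeight a (b + 1) = ktWeight a b * ((b + 1 / 2) / ((a + b : ℕ) + 1)) := by
  rw [ktWeight_comm, ktWeight_succ_left, ktWeight_comm, add_comm b a]

/-- The Krichevsky–Trofimov probabilities of the words of length `n` sum to one. -/
lemma sum_choose_mul_ktWeight (n : ℕ) :
    ∑ ij ∈ Finset.HasAntidiagonal.antidiagonal n, (n.choose ij.1 : ℝ) * ktWeight ij.1 ij.2 = 1 := by
  induction n with
  | zero => simp [ktWeight]
  | succ n ih =>
    rw [Finset.sum_antidiagonal_choose_succ_mul, ← Finset.sum_add_distrib, ← ih]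
    refine Finset.sum_congr rfl fun ij hij => ?_
    obtain rfl : ij.1 + ij.2 = n := Finset.HasAntidiagonal.mem_antidiagonal.1 hij
    rw [ktWeight_succ_left, ktWeight_succ_right, ← Nat.choose_symm_add]
    push_cast
    field_simp
    ring

/-- The Hermite–Hadamard inequality for the logarithm on `[a, a + 1]`, exponentiated. -/
lemma succ_pow_succ_le (a : ℕ) :
    ((a : ℝ) + 1) ^ (a + 1) ≤ Real.exp 1 * (a + 1 / 2) * (a : ℝ) ^ a := by
  rcases Nat.eq_zero_or_pos a with rfl | ha
  · have := Real.add_one_le_exp (1 : ℝ)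
    norm_num
    linarith
  have ha' : (0 : ℝ) < a := by exact_mod_cast ha
  have key : ((a : ℝ) + 1) * Real.log (a + 1) - a * Real.log a - (a + 1) + a
      ≤ Real.log (a + 1 / 2) := by
    rw [← integral_log]
    have hm : (0 : ℝ) < a + 1 / 2 := by positivity
    calc ∫ x in (a : ℝ)..(a + 1), Real.log x
        ≤ ∫ x in (a : ℝ)..(a + 1), (Real.log (a + 1 / 2) - 1 + (a + 1 / 2 : ℝ)⁻¹ * x) := by
          refine intervalIntegral.integral_mono_on (by linarith)
            intervalIntegral.intervalIntegrable_log' ?_ fun x hx => ?_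
          · exact Continuous.intervalIntegrable (by fun_prop) _ _
          · have hx0 : 0 < x := lt_of_lt_of_le ha' hx.1
            have h := Real.log_le_sub_one_of_pos (div_pos hx0 hm)
            rw [Real.log_div hx0.ne' hm.ne', div_eq_inv_mul x] at h
            linarith
      _ = Real.log (a + 1 / 2) := by
          rw [intervalIntegral.integral_add (Continuous.intervalIntegrable (by fun_prop) _ _)
            (Continuous.intervalIntegrable (by fun_prop) _ _),
            intervalIntegral.integral_const_mul, integral_id, intervalIntegral.integral_const]
          simp only [smul_eq_mul]
          field_simp
          ring
  rw [← Real.log_le_log_iff (by positivity) (by positivity),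
    Real.log_mul (by positivity) (by positivity), Real.log_mul (by positivity) (by positivity),
    Real.log_exp, Real.log_pow, Real.log_pow]
  push_cast
  linarith

/-- The inequality `1 ≤ (n + 1/2) log (1 + 1/n)`, exponentiated. -/
lemma exp_one_mul_sqrt_mul_pow_le (n : ℕ) (hn : 0 < n) :
    Real.exp 1 * √(n : ℝ) * (n : ℝ) ^ n ≤ √((n : ℝ) + 1) * ((n : ℝ) + 1) ^ n := by
  have hn' : (0 : ℝ) < n := by exact_mod_cast hn
  have h := Real.le_log_one_add_of_nonneg (x := 1 / (n : ℝ)) (by positivity)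
  rw [show 1 + 1 / (n : ℝ) = (n + 1) / n by field_simp,
    Real.log_div (by positivity) (by positivity),
    show 2 * (1 / (n : ℝ)) / (1 / n + 2) = 1 / (n + 1 / 2) by field_simp; ring,
    div_le_iff₀ (by positivity)] at h
  rw [← Real.log_le_log_iff (by positivity) (by positivity),
    Real.log_mul (by positivity) (by positivity), Real.log_mul (by positivity) (by positivity),
    Real.log_mul (by positivity) (by positivity),
    Real.log_exp, Real.log_pow, Real.log_pow, Real.log_sqrt (by positivity),
    Real.log_sqrt (by positivity)]
  linarith

/-- The redundancy bound passes from `(a, b)` to `(a + 1, b)`. The factor `(a + 1)^(a+1) / a^a` gained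
on the left is at most `e (a + 1/2)`, the factor gained on the right is at least that. -/
lemma pow_mul_pow_le_succ {a b : ℕ} (hab : 0 < a + b)
    (h : (a : ℝ) ^ a * (b : ℝ) ^ b
      ≤ 2 * √((a + b : ℕ) : ℝ) * ((a + b : ℕ) : ℝ) ^ (a + b) * ktWeight a b) :
    ((a + 1 : ℕ) : ℝ) ^ (a + 1) * (b : ℝ) ^ b
      ≤ 2 * √((a + 1 + b : ℕ) : ℝ) * ((a + 1 + b : ℕ) : ℝ) ^ (a + 1 + b) * ktWeight (a + 1) b := by
  rw [ktWeight_succ_left, show a + 1 + b = a + b + 1 by ring]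
  have h2 := exp_one_mul_sqrt_mul_pow_le _ hab
  generalize a + b = n at *
  have h1 := succ_pow_succ_le a
  have hk := ktWeight_nonneg a b
  push_cast
  calc ((a : ℝ) + 1) ^ (a + 1) * (b : ℝ) ^ b
      ≤ Real.exp 1 * (a + 1 / 2) * (a : ℝ) ^ a * (b : ℝ) ^ b := by gcongr
    _ = Real.exp 1 * (a + 1 / 2) * ((a : ℝ) ^ a * (b : ℝ) ^ b) := by ring
    _ ≤ Real.exp 1 * (a + 1 / 2) * (2 * √(n : ℝ) * (n : ℝ) ^ n * ktWeight a b) := by gcongr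
    _ = (a + 1 / 2) * 2 * ktWeight a b * (Real.exp 1 * √(n : ℝ) * (n : ℝ) ^ n) := by ring
    _ ≤ (a + 1 / 2) * 2 * ktWeight a b * (√((n : ℝ) + 1) * ((n : ℝ) + 1) ^ n) := by gcongr
    _ = _ := by
      rw [pow_succ]
      field_simp

/-- The pointwise redundancy of the Krichevsky–Trofimov mixture: the maximum likelihood of a word
of length `n` exceeds its mixture probability by at most the factor `2 √n`. -/
lemma pow_mul_pow_le_ktWeight (a b : ℕ) (hab : 0 < a + b) :
    (a : ℝ) ^ a * (b : ℝ) ^ b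
      ≤ 2 * √((a + b : ℕ) : ℝ) * ((a + b : ℕ) : ℝ) ^ (a + b) * ktWeight a b := by
  have hsymm : ∀ {a b : ℕ}, (a : ℝ) ^ a * (b : ℝ) ^ b
      ≤ 2 * √((a + b : ℕ) : ℝ) * ((a + b : ℕ) : ℝ) ^ (a + b) * ktWeight a b →
      (b : ℝ) ^ b * (a : ℝ) ^ a
      ≤ 2 * √((b + a : ℕ) : ℝ) * ((b + a : ℕ) : ℝ) ^ (b + a) * ktWeight b a := by
    intro a b h
    rwa [mul_comm ((b : ℝ) ^ b), ktWeight_comm b a, add_comm b a]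
  have hzero : ∀ b : ℕ, 0 < b → ((b : ℕ) : ℝ) ^ b * ((0 : ℕ) : ℝ) ^ 0
      ≤ 2 * √((b + 0 : ℕ) : ℝ) * ((b + 0 : ℕ) : ℝ) ^ (b + 0) * ktWeight b 0 := by
    intro b hb
    induction b, hb using Nat.le_induction with
    | base => simp [ktWeight]
    | succ m hm ih => exact pow_mul_pow_le_succ (by omega) ih
  rcases Nat.eq_zero_or_pos b with rfl | hb
  · exact hzero a (by omega)
  induction a with
  | zero => exact hsymm (hzero b hb)
  | succ a ih => exact pow_mul_pow_le_succ (by omega) (ih (by omega))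

/-- The maximum likelihood `(k/n)^k (1 - k/n)^(n-k)` of a binary word of length `n` with `k`
ones. -/
def maxLikelihood (n k : ℕ) : ℝ := ((k : ℝ) / n) ^ k * (((n - k : ℕ) : ℝ) / n) ^ (n - k)

lemma maxLikelihood_pos {n k : ℕ} (hk : k ≤ n) : 0 < maxLikelihood n k := by
  have aux : ∀ m : ℕ, m ≤ n → 0 < ((m : ℝ) / n) ^ m := by
    intro m hm
    rcases Nat.eq_zero_or_pos m with rfl | h
    · simp
    · have : 0 < n := by omega
      positivity
  exact mul_pos (aux k hk) (aux (n - k) (by omega))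

lemma maxLikelihood_le {n k : ℕ} (hn : 0 < n) (hk : k ≤ n) :
    maxLikelihood n k ≤ 2 * √(n : ℝ) * ktWeight k (n - k) := by
  have h := pow_mul_pow_le_ktWeight k (n - k) (by omega)
  rw [Nat.add_sub_cancel' hk] at h
  have hn' : (0 : ℝ) < n := by exact_mod_cast hn
  rw [maxLikelihood, div_pow, div_pow, div_mul_div_comm, ← pow_add, Nat.add_sub_cancel' hk,
    div_le_iff₀ (by positivity)]
  linarith

/-- The Shtarkov sum of the Bernoulli model is at most `2 √n`. -/
lemma sum_choose_mul_maxLikelihood_le {n : ℕ} (hn : 0 < n) :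
    ∑ k ∈ Finset.range (n + 1), (n.choose k : ℝ) * maxLikelihood n k ≤ 2 * √(n : ℝ) := by
  calc ∑ k ∈ Finset.range (n + 1), (n.choose k : ℝ) * maxLikelihood n k
      ≤ ∑ k ∈ Finset.range (n + 1), 2 * √(n : ℝ) * ((n.choose k : ℝ) * ktWeight k (n - k)) := by
        refine Finset.sum_le_sum fun k hk => ?_
        have := maxLikelihood_le hn (Nat.lt_succ_iff.1 (Finset.mem_range.1 hk))
        calc _ ≤ (n.choose k : ℝ) * (2 * √(n : ℝ) * ktWeight k (n - k)) := by gcongr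
          _ = _ := by ring
    _ = 2 * √(n : ℝ) := by
        rw [← Finset.mul_sum, ← Finset.Nat.sum_antidiagonal_eq_sum_range_succ
          (fun i j => (n.choose i : ℝ) * ktWeight i j), sum_choose_mul_ktWeight, mul_one]

end SplitKL

end

/-! ### The exponential moment of the binary Kullback–Leibler divergence -/

noncomputable section

namespace SplitKL

/-- The exponential `exp (n kl(k/n‖y))`, as the likelihood ratio of the biases `k/n` and `y` on a
binary word of length `n` with `k` ones. It is infinite where the denominator vanishes. -/
def expKL (n k : ℕ) (y : ℝ) : ℝ≥0∞ :=
  ENNReal.ofReal (maxLikelihood n k) / ENNReal.ofReal (y ^ k * (1 - y) ^ (n - k))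

open scoped Classical in
/-- The number of points of the sample `s` that lie in `B`. -/
def hits {𝒵 : Type*} {n : ℕ} (B : Set 𝒵) (s : Fin n → 𝒵) : ℕ :=
  (Finset.univ.filter fun i => s i ∈ B).card

lemma hits_le {𝒵 : Type*} {n : ℕ} (B : Set 𝒵) (s : Fin n → 𝒵) : hits B s ≤ n := by
  classical
  simpa [hits] using Finset.card_filter_le (Finset.univ : Finset (Fin n)) fun i => s i ∈ B

section

variable {Ω H 𝒵 E : Type*} {n : ℕ} [MeasurableSpace Ω] [MeasurableSpace H] [MeasurableSpace 𝒵]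
  [MeasurableSpace E]

/-- For an i.i.d. sample, the events that fix which of its points lie in `B` are rectangles, and the
likelihood in the denominator of `expKL` cancels against their probabilities: the expectation is
the Shtarkov sum. -/
lemma lintegral_expKL_hits_le (hn : 0 < n) (D : Measure 𝒵) [IsProbabilityMeasure D] {B : Set 𝒵}
    (hB : MeasurableSet B) :
    ∫⁻ s, expKL n (hits B s) (D.real B) ∂(Measure.pi fun _ : Fin n => D)
      ≤ ENNReal.ofReal (2 * √(n : ℝ)) := by
  classical
  set y := D.real B
  have hy0 : 0 ≤ y := measureReal_nonneg
  have hy1 : y ≤ 1 := measureReal_le_one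
  let C : Finset (Fin n) → Set (Fin n → 𝒵) := fun T =>
    Set.pi Set.univ fun i => if i ∈ T then B else Bᶜ
  have hC : ∀ T, MeasurableSet (C T) := fun T =>
    MeasurableSet.univ_pi fun i => by split_ifs <;> [exact hB; exact hB.compl]
  have hmem : ∀ s T, s ∈ C T ↔ (Finset.univ.filter fun i => s i ∈ B) = T := by
    intro s T
    simp only [C, Set.mem_univ_pi, Finset.ext_iff, Finset.mem_filter, Finset.mem_univ, true_and]
    refine forall_congr' fun i => ?_
    by_cases h : i ∈ T <;> simp [h]
  have hprob : ∀ T, (Measure.pi fun _ : Fin n => D) (C T)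
      = ENNReal.ofReal (y ^ T.card * (1 - y) ^ (n - T.card)) := by
    intro T
    have h1 : D B = ENNReal.ofReal y := (ofReal_measureReal (measure_ne_top _ _)).symm
    have h2 : D Bᶜ = ENNReal.ofReal (1 - y) := by
      rw [← probReal_compl_eq_one_sub hB, ofReal_measureReal (measure_ne_top _ _)]
    rw [Measure.pi_pi, ENNReal.ofReal_mul (by positivity), ENNReal.ofReal_pow hy0,
      ENNReal.ofReal_pow (by linarith), ← h1, ← h2]
    simp_rw [apply_ite D]
    rw [Finset.prod_ite, Finset.prod_const, Finset.prod_const, Finset.filter_not,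
      Finset.card_sdiff_of_subset (Finset.filter_subset _ _)]
    simp
  calc ∫⁻ s, expKL n (hits B s) y ∂(Measure.pi fun _ : Fin n => D)
      = ∫⁻ s, ∑ T : Finset (Fin n), (C T).indicator (fun _ => expKL n T.card y) s
          ∂(Measure.pi fun _ : Fin n => D) := by
        refine lintegral_congr fun s => ?_
        simp [Set.indicator_apply, hmem, hits]
    _ = ∑ T : Finset (Fin n), expKL n T.card y
          * ENNReal.ofReal (y ^ T.card * (1 - y) ^ (n - T.card)) := by
        rw [lintegral_finsetSum _ fun T _ => measurable_const.indicator (hC T)]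
        simp_rw [lintegral_indicator_const (hC _), hprob]
    _ ≤ ∑ T : Finset (Fin n), ENNReal.ofReal (maxLikelihood n T.card) :=
        Finset.sum_le_sum fun T _ => by
          rw [mul_comm]
          exact ENNReal.mul_div_le
    _ = ENNReal.ofReal (∑ k ∈ Finset.range (n + 1), (n.choose k : ℝ) * maxLikelihood n k) := by
        rw [← ENNReal.ofReal_sum_of_nonneg fun T _ =>
          (maxLikelihood_pos (by simpa using Finset.card_le_univ T)).le,
          ← Finset.powerset_univ, Finset.sum_powerset_apply_card fun k => maxLikelihood n k]
        simp
    _ ≤ ENNReal.ofReal (2 * √(n : ℝ)) :=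
        ENNReal.ofReal_le_ofReal (sum_choose_mul_maxLikelihood_le hn)

lemma measurable_expKL {N : H → ℕ} {p : H → ℝ} (hN : Measurable N) (hp : Measurable p) :
    Measurable fun h => expKL n (N h) (p h) := by
  refine Measurable.div ?_ ?_
  · exact (measurable_from_top (f := fun k : ℕ => ENNReal.ofReal (maxLikelihood n k))).comp hN
  · exact ((hp.pow hN).mul ((measurable_const.sub hp).pow
      ((measurable_from_top (f := fun k : ℕ => n - k)).comp hN))).ennreal_ofReal

lemma measurable_hits_section {A : Set (H × 𝒵)} (hA : MeasurableSet A) :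
    Measurable fun x : H × (Fin n → 𝒵) => hits (Prod.mk x.1 ⁻¹' A) x.2 := by
  classical
  simp only [hits, Finset.card_filter]
  refine Finset.measurable_sum _ fun i _ => Measurable.ite ?_ measurable_const measurable_const
  exact (measurable_fst.prodMk ((measurable_pi_apply i).comp measurable_snd)) hA

lemma measurable_measureReal_section (D : Measure 𝒵) [IsProbabilityMeasure D] {A : Set (H × 𝒵)}
    (hA : MeasurableSet A) : Measurable fun h => D.real (Prod.mk h ⁻¹' A) :=
  (measurable_measure_prodMk_left hA).ennreal_toReal

lemma measurable_expKL_section (D : Measure 𝒵) [IsProbabilityMeasure D] {A : Set (H × 𝒵)}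
    (hA : MeasurableSet A) : Measurable fun x : H × (Fin n → 𝒵) =>
      expKL n (hits (Prod.mk x.1 ⁻¹' A) x.2) (D.real (Prod.mk x.1 ⁻¹' A)) := by
  have h1 := measurable_hits_section (n := n) hA
  have h2 : Measurable fun x : H × (Fin n → 𝒵) => D.real (Prod.mk x.1 ⁻¹' A) :=
    (measurable_measureReal_section D hA).comp measurable_fst
  exact measurable_expKL h1 h2

/-- Tonelli's theorem for a random probability measure that is independent of a random variable:
the average over the random measure may be taken after the expectation over the variable. -/
lemma lintegral_lintegral_kernel_le_of_indepFun {P : Measure Ω} [IsProbabilityMeasure P]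
    {S : Ω → E} (hS : Measurable S) (π : Kernel Ω H) [IsMarkovKernel π]
    (hπ : IndepFun (fun ω => π ω) S P) {g : H × E → ℝ≥0∞} (hg : Measurable g) {C : ℝ≥0∞}
    (hC : ∀ h, ∫⁻ s, g (h, s) ∂(P.map S) ≤ C) :
    ∫⁻ ω, ∫⁻ h, g (h, S ω) ∂(π ω) ∂P ≤ C := by
  classical
  have hprob : MeasurableSet {m : Measure H | m Set.univ = 1} :=
    Measure.measurable_coe MeasurableSet.univ (measurableSet_singleton 1)
  -- The identity kernel on `Measure H`, cut off to the probability measures: it must be finite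
  -- for integrals against it to depend measurably on parameters.
  let κ : Kernel (Measure H) H := Kernel.piecewise hprob ⟨id, measurable_id⟩ 0
  have hκ : ∀ m : Measure H, m Set.univ = 1 → κ m = m := by
    intro m hm
    exact (Kernel.piecewise_apply ..).trans (if_pos hm)
  have hκ' : ∀ m, κ m Set.univ ≤ 1 := by
    intro m
    by_cases hm : m Set.univ = 1
    · rw [hκ m hm, hm]
    · rw [show κ m = 0 from (Kernel.piecewise_apply ..).trans (if_neg hm)]
      simp
  have : IsFiniteKernel κ := ⟨⟨1, ENNReal.one_lt_top, hκ'⟩⟩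
  have := Measure.isProbabilityMeasure_map (μ := P) hS.aemeasurable
  have := Measure.isProbabilityMeasure_map (μ := P) π.measurable.aemeasurable
  have hG : Measurable fun x : Measure H × E => ∫⁻ h, g (h, x.2) ∂(κ x.1) := by
    have := Measurable.lintegral_kernel_prod_right (κ := κ.prodMkRight E)
      (f := fun (x : Measure H × E) h => g (h, x.2))
      (hg.comp (measurable_snd.prodMk (measurable_snd.comp measurable_fst)))
    simpa only [Kernel.prodMkRight_apply] using this
  calc ∫⁻ ω, ∫⁻ h, g (h, S ω) ∂(π ω) ∂P
      = ∫⁻ ω, ∫⁻ h, g (h, S ω) ∂(κ (π ω)) ∂P := by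
        simp_rw [hκ _ (measure_univ (μ := π _))]
    _ = ∫⁻ x, ∫⁻ h, g (h, x.2) ∂(κ x.1) ∂((P.map fun ω => π ω).prod (P.map S)) := by
        rw [← (indepFun_iff_map_prod_eq_prod_map_map π.measurable.aemeasurable
          hS.aemeasurable).1 hπ, lintegral_map hG (π.measurable.prodMk hS)]
    _ = ∫⁻ m, ∫⁻ s, ∫⁻ h, g (h, s) ∂(κ m) ∂(P.map S) ∂(P.map fun ω => π ω) :=
        lintegral_prod _ hG.aemeasurable
    _ = ∫⁻ m, ∫⁻ h, ∫⁻ s, g (h, s) ∂(P.map S) ∂(κ m) ∂(P.map fun ω => π ω) := by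
        refine lintegral_congr fun m => ?_
        exact lintegral_lintegral_swap (hg.comp measurable_swap).aemeasurable
    _ ≤ ∫⁻ _, C ∂(P.map fun ω => π ω) := by
        refine lintegral_mono fun m => ?_
        calc _ ≤ ∫⁻ _, C ∂(κ m) := lintegral_mono hC
          _ ≤ C := by
            rw [lintegral_const]
            exact mul_le_of_le_one_right' (hκ' m)
    _ = C := by simp

lemma lintegral_lintegral_expKL_le {P : Measure Ω} [IsProbabilityMeasure P] (D : Measure 𝒵)
    [IsProbabilityMeasure D] (hn : 0 < n) {Z : Fin n → Ω → 𝒵} (hZ : ∀ i, Measurable (Z i))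
    (hlaw : ∀ i, P.map (Z i) = D) (hindep : iIndepFun Z P) (π : Kernel Ω H) [IsMarkovKernel π]
    (hπ : IndepFun (fun ω => π ω) (fun ω i => Z i ω) P) {A : Set (H × 𝒵)}
    (hA : MeasurableSet A) :
    ∫⁻ ω, ∫⁻ h, expKL n (hits (Prod.mk h ⁻¹' A) fun i => Z i ω) (D.real (Prod.mk h ⁻¹' A))
        ∂(π ω) ∂P ≤ ENNReal.ofReal (2 * √(n : ℝ)) := by
  refine lintegral_lintegral_kernel_le_of_indepFun (measurable_pi_lambda _ hZ) π hπ
    (measurable_expKL_section D hA) fun h => ?_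
  rw [(iIndepFun_iff_map_fun_eq_pi_map fun i => (hZ i).aemeasurable).1 hindep]
  simp_rw [hlaw]
  exact lintegral_expKL_hits_le hn D (measurable_prodMk_left hA)

end

end SplitKL

end

/-! ### Change of measure and joint convexity -/

noncomputable section

namespace SplitKL

open InformationTheory Filter Topology
open Real (exp log exp_pos exp_add exp_sub exp_log exp_nat_mul log_pow log_div exp_le_one_iff
  add_one_le_exp measurable_exp)

/-- The Donsker–Varadhan inequality for a function `ℓ` whose exponential is dominated, almost
everywhere for `ρ`, by a function `W` of known `π`-expectation. -/
lemma integral_le_klDiv_add_log {H : Type*} [MeasurableSpace H] {ρ π : Measure H}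
    [IsProbabilityMeasure ρ] [IsProbabilityMeasure π] (hKL : klDiv ρ π ≠ ∞) {ℓ : H → ℝ}
    (hℓ : Integrable ℓ ρ) {W : H → ℝ≥0∞} (hWm : Measurable W)
    (hW : ∀ᵐ h ∂ρ, ENNReal.ofReal (exp (ℓ h)) ≤ W h) {M : ℝ} (hM : 0 < M)
    (hWM : ∫⁻ h, W h ∂π ≤ ENNReal.ofReal M) :
    ∫ h, ℓ h ∂ρ ≤ (klDiv ρ π).toReal + log M := by
  obtain ⟨hac, hint⟩ := klDiv_ne_top_iff.1 hKL
  rw [toReal_klDiv_of_measure_eq hac (by simp)]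
  -- `u` is the logarithm of the density of a sub-probability with respect to `ρ`.
  set u : H → ℝ := fun h => ℓ h - llr ρ π h - log M with hu
  have hui : Integrable u ρ := (hℓ.sub hint).sub (integrable_const _)
  have hle : ∫⁻ h, ENNReal.ofReal (exp (u h)) ∂ρ ≤ 1 := by
    calc ∫⁻ h, ENNReal.ofReal (exp (u h)) ∂ρ
        ≤ ∫⁻ h, W h / (ρ.rnDeriv π h * ENNReal.ofReal M) ∂ρ := by
          refine lintegral_mono_ae ?_
          filter_upwards [hW, Measure.rnDeriv_pos hac, hac.ae_le (Measure.rnDeriv_lt_top ρ π)]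
            with h hWh hpos hlt
          have hr : 0 < (ρ.rnDeriv π h).toReal := ENNReal.toReal_pos hpos.ne' hlt.ne
          have hexp : exp (u h) = exp (ℓ h) / ((ρ.rnDeriv π h).toReal * M) := by
            simp only [hu, llr]
            rw [exp_sub, exp_sub, exp_log hr, exp_log hM, div_div]
          rw [hexp, ENNReal.ofReal_div_of_pos (by positivity), ENNReal.ofReal_mul hr.le,
            ENNReal.ofReal_toReal hlt.ne]
          gcongr
      _ = ∫⁻ h, ρ.rnDeriv π h * (W h / (ρ.rnDeriv π h * ENNReal.ofReal M)) ∂π :=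
          (lintegral_rnDeriv_mul hac (hWm.div ((Measure.measurable_rnDeriv ρ π).mul
            measurable_const)).aemeasurable).symm
      _ ≤ ∫⁻ h, W h / ENNReal.ofReal M ∂π := by
          refine lintegral_mono_ae ?_
          filter_upwards [Measure.rnDeriv_lt_top ρ π] with h hlt
          rcases eq_or_ne (ρ.rnDeriv π h) 0 with h0 | h0
          · simp [h0]
          · rw [← mul_div_assoc, ENNReal.mul_div_mul_left _ _ h0 hlt.ne]
      _ = (∫⁻ h, W h ∂π) / ENNReal.ofReal M := by
          simp_rw [div_eq_mul_inv]
          exact lintegral_mul_const _ hWm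
      _ ≤ 1 := ENNReal.div_le_of_le_mul (by rwa [one_mul])
  have hei : Integrable (fun h => exp (u h)) ρ := by
    refine ⟨(measurable_exp.comp_aemeasurable hui.aemeasurable).aestronglyMeasurable, ?_⟩
    rw [hasFiniteIntegral_iff_ofReal (ae_of_all _ fun h => (exp_pos _).le)]
    exact hle.trans_lt ENNReal.one_lt_top
  have h1 : ∫ h, exp (u h) ∂ρ ≤ 1 := by
    rw [integral_eq_lintegral_of_nonneg_ae (ae_of_all _ fun h => (exp_pos _).le) hei.1]
    exact ENNReal.toReal_le_of_le_ofReal zero_le_one (by simpa using hle)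
  have h2 : ∫ h, (u h + 1) ∂ρ ≤ ∫ h, exp (u h) ∂ρ :=
    integral_mono (hui.add (integrable_const _)) hei fun h => add_one_le_exp _
  have h3 : ∫ h, u h ∂ρ = ∫ h, ℓ h ∂ρ - ∫ h, llr ρ π h ∂ρ - log M := by
    have h4 : Integrable (fun h => ℓ h - llr ρ π h) ρ := hℓ.sub hint
    rw [hu, integral_sub h4 (integrable_const _), integral_sub hℓ hint]
    simp
  rw [integral_add hui (integrable_const _), h3] at h2
  simp only [integral_const, probReal_univ, smul_eq_mul, mul_one] at h2
  linarith

lemma exp_mul_pow_le {k : ℕ} {n y r : ℝ} (hn : 0 < n) (hy : 0 ≤ y) (hr : 0 ≤ r)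
    (hrk : r = 0 → k = 0) : exp (k * log r + k - n * y * r) * y ^ k ≤ (k / n) ^ k := by
  rcases Nat.eq_zero_or_pos k with rfl | hk
  · simp only [Nat.cast_zero, zero_mul, add_zero, zero_sub, pow_zero, mul_one, exp_le_one_iff]
    have : 0 ≤ n * y * r := by positivity
    linarith
  have hr' : 0 < r := lt_of_le_of_ne hr fun h => hk.ne' (hrk h.symm)
  have hk' : (0 : ℝ) < k := by exact_mod_cast hk
  have h1 : exp (k * log r + k - n * y * r) = (r * exp (1 - n * y * r / k)) ^ k := by
    rw [mul_pow, ← exp_nat_mul, ← Real.exp_log (pow_pos hr' k), ← exp_add, log_pow]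
    congr 1
    field_simp
    ring
  rw [h1, ← mul_pow]
  refine pow_le_pow_left₀ (by positivity) ?_ k
  -- This is `t * exp (1 - t) ≤ 1` at `t = n * y * r / k`.
  have h2 : n * y * r / k ≤ exp (n * y * r / k - 1) := by
    have := add_one_le_exp (n * y * r / k - 1)
    linarith
  have h3 : n * y * r / k * exp (1 - n * y * r / k) ≤ 1 := by
    calc _ ≤ exp (n * y * r / k - 1) * exp (1 - n * y * r / k) := by gcongr
      _ = 1 := by rw [← exp_add]; simp
  calc r * exp (1 - n * y * r / k) * y
      = k / n * (n * y * r / k * exp (1 - n * y * r / k)) := by field_simp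
    _ ≤ k / n * 1 := by gcongr
    _ = k / n := mul_one _

/-- `n` times the tangent plane at `(x₀, y₀)` of the jointly convex function `(x, y) ↦ kl(x‖y)`,
evaluated at `(k/n, y)`. -/
def klTangent (n : ℕ) (x₀ y₀ : ℝ) (k : ℕ) (y : ℝ) : ℝ :=
  (k * log (x₀ / y₀) + k - n * y * (x₀ / y₀))
    + ((n - k : ℕ) * log ((1 - x₀) / (1 - y₀)) + (n - k : ℕ)
      - n * (1 - y) * ((1 - x₀) / (1 - y₀)))

/-- Joint convexity of the binary Kullback–Leibler divergence: its graph lies above its tangent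
planes. At the boundary values of `x₀` a tangent plane is vertical, and the inequality is confined
to the matching value of `k`. -/
lemma exp_klTangent_le_expKL {n k : ℕ} (hn : 0 < n) (hk : k ≤ n) {x₀ y₀ y : ℝ}
    (hx₀ : x₀ ∈ Set.Icc (0 : ℝ) 1) (hy₀ : y₀ ∈ Set.Ioo (0 : ℝ) 1) (hy : y ∈ Set.Icc (0 : ℝ) 1)
    (h0 : x₀ = 0 → k = 0) (h1 : x₀ = 1 → k = n) :
    ENNReal.ofReal (exp (klTangent n x₀ y₀ k y)) ≤ expKL n k y := by
  have hy₀' : 0 < 1 - y₀ := by linarith [hy₀.2]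
  have hn' : (0 : ℝ) < n := by exact_mod_cast hn
  have hA := exp_mul_pow_le (k := k) (r := x₀ / y₀) hn' hy.1 (div_nonneg hx₀.1 hy₀.1.le)
    fun h => h0 ((div_eq_zero_iff.1 h).resolve_right hy₀.1.ne')
  have hB := exp_mul_pow_le (k := n - k) (y := 1 - y) (r := (1 - x₀) / (1 - y₀)) hn'
    (by linarith [hy.2]) (div_nonneg (by linarith [hx₀.2]) hy₀'.le) fun h => by
      have := (div_eq_zero_iff.1 h).resolve_right hy₀'.ne'
      have := h1 (by linarith)
      omega
  have hy1 : 0 ≤ 1 - y := by linarith [hy.2]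
  rw [expKL, ENNReal.le_div_iff_mul_le (Or.inr (by simpa using maxLikelihood_pos hk))
    (Or.inl ENNReal.ofReal_ne_top), ← ENNReal.ofReal_mul (exp_pos _).le]
  refine ENNReal.ofReal_le_ofReal ?_
  rw [klTangent, exp_add, mul_mul_mul_comm, maxLikelihood]
  exact mul_le_mul hA hB (by have := hy.1; positivity) (by positivity)

/-- The real expression of the binary Kullback–Leibler divergence. It represents `binKL` where the
latter is finite. -/
def bernKL (x y : ℝ) : ℝ := x * (log x - log y) + (1 - x) * (log (1 - x) - log (1 - y))

lemma mul_log_div_eq {x y : ℝ} (hy : y ≠ 0) : x * log (x / y) = x * (log x - log y) := by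
  rcases eq_or_ne x 0 with rfl | hx
  · simp
  · rw [log_div hx hy]

lemma div_mem_Icc {H : Type*} {n : ℕ} {N : H → ℕ} (hn : 0 < n) (hNn : ∀ h, N h ≤ n) (h : H) :
    (N h : ℝ) / n ∈ Set.Icc (0 : ℝ) 1 :=
  ⟨by positivity, div_le_one_of_le₀ (by exact_mod_cast hNn h) (by positivity)⟩

section

variable {H : Type*} [MeasurableSpace H] {ρ π : Measure H} [IsProbabilityMeasure ρ]
  {n : ℕ} {N : H → ℕ} {p : H → ℝ}

lemma integrable_natCast_of_le (hN : Measurable N) (hNn : ∀ h, N h ≤ n) :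
    Integrable (fun h => (N h : ℝ)) ρ :=
  Integrable.of_bound (measurable_from_top.comp hN).aestronglyMeasurable (n : ℝ)
    (ae_of_all _ fun h => by simpa using hNn h)

lemma integrable_of_mem_Icc (hp : Measurable p) (hp01 : ∀ h, p h ∈ Set.Icc (0 : ℝ) 1) :
    Integrable p ρ :=
  Integrable.of_bound hp.aestronglyMeasurable 1
    (ae_of_all _ fun h => by simpa [abs_of_nonneg (hp01 h).1] using (hp01 h).2)

lemma integral_mem_Icc (hp : Measurable p) (hp01 : ∀ h, p h ∈ Set.Icc (0 : ℝ) 1) :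
    ∫ h, p h ∂ρ ∈ Set.Icc (0 : ℝ) 1 := by
  refine ⟨integral_nonneg fun h => (hp01 h).1, ?_⟩
  simpa using integral_mono (integrable_of_mem_Icc (ρ := ρ) hp hp01) (integrable_const 1)
    fun h => (hp01 h).2

lemma ae_eq_zero_of_integral_eq_zero (hp : Measurable p) (hp01 : ∀ h, p h ∈ Set.Icc (0 : ℝ) 1)
    (h0 : ∫ h, p h ∂ρ = 0) : ∀ᵐ h ∂ρ, p h = 0 :=
  (integral_eq_zero_iff_of_nonneg (fun h => (hp01 h).1) (integrable_of_mem_Icc hp hp01)).1 h0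

lemma ae_eq_one_of_integral_eq_one (hp : Measurable p) (hp01 : ∀ h, p h ∈ Set.Icc (0 : ℝ) 1)
    (h1 : ∫ h, p h ∂ρ = 1) : ∀ᵐ h ∂ρ, p h = 1 := by
  have h := ae_eq_zero_of_integral_eq_zero (ρ := ρ) (p := fun h => 1 - p h)
    (measurable_const.sub hp) (fun h => ⟨by linarith [(hp01 h).2], by linarith [(hp01 h).1]⟩)
    (by rw [integral_sub (integrable_const _) (integrable_of_mem_Icc hp hp01)]; simp [h1])
  filter_upwards [h] with a ha
  linarith

/-- The PAC-Bayes change of measure for a single binary loss, away from the boundary values of the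
averaged bias. -/
lemma mul_bernKL_le_klDiv_add_log [IsProbabilityMeasure π] (hn : 0 < n) (hN : Measurable N) (hNn : ∀ h, N h ≤ n)
    (hp : Measurable p) (hp01 : ∀ h, p h ∈ Set.Icc (0 : ℝ) 1) (hKL : klDiv ρ π ≠ ∞)
    {M : ℝ} (hM : 0 < M) (hWM : ∫⁻ h, expKL n (N h) (p h) ∂π ≤ ENNReal.ofReal M)
    (hy : ∫ h, p h ∂ρ ∈ Set.Ioo (0 : ℝ) 1) :
    n * bernKL (∫ h, (N h : ℝ) / n ∂ρ) (∫ h, p h ∂ρ) ≤ (klDiv ρ π).toReal + log M := by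
  have hxm : Measurable fun h => (N h : ℝ) / n :=
    (measurable_from_top.comp hN : Measurable fun h => (N h : ℝ)).div_const _
  have hx01 := div_mem_Icc hn hNn
  have hn' : (0 : ℝ) < n := by exact_mod_cast hn
  have hxi := integral_mem_Icc (ρ := ρ) hxm hx01
  have hpi := integrable_of_mem_Icc (ρ := ρ) hp hp01
  have hNi := integrable_natCast_of_le (ρ := ρ) hN hNn
  have hz := ae_eq_zero_of_integral_eq_zero (ρ := ρ) hxm hx01
  have ho := ae_eq_one_of_integral_eq_one (ρ := ρ) hxm hx01
  have hNx : ∫ h, (N h : ℝ) ∂ρ = n * ∫ h, (N h : ℝ) / n ∂ρ := by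
    rw [integral_div]
    field_simp
  generalize hx₀ : ∫ h, (N h : ℝ) / n ∂ρ = x₀ at *
  generalize hy₀ : ∫ h, p h ∂ρ = y₀ at *
  have hW : ∀ᵐ h ∂ρ, ENNReal.ofReal (exp (klTangent n x₀ y₀ (N h) (p h)))
      ≤ expKL n (N h) (p h) := by
    have hz' : ∀ᵐ h ∂ρ, x₀ = 0 → N h = 0 := by
      by_cases hx : x₀ = 0
      · filter_upwards [hz hx] with h hh _
        simpa [hn.ne'] using hh
      · exact ae_of_all _ fun h h0 => absurd h0 hx
    have ho' : ∀ᵐ h ∂ρ, x₀ = 1 → N h = n := by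
      by_cases hx : x₀ = 1
      · filter_upwards [ho hx] with h hh _
        rw [div_eq_one_iff_eq hn'.ne'] at hh
        exact_mod_cast hh
      · exact ae_of_all _ fun h h0 => absurd h0 hx
    filter_upwards [hz', ho'] with h h0 h1
    exact exp_klTangent_le_expKL hn (hNn h) hxi hy (hp01 h) h0 h1
  -- The tangent plane is affine in `(k, y)`, so its average is its value at the average.
  have hlin : ∀ h, klTangent n x₀ y₀ (N h) (p h)
      = (log (x₀ / y₀) - log ((1 - x₀) / (1 - y₀))) * N h
        + (n * ((1 - x₀) / (1 - y₀)) - n * (x₀ / y₀)) * p h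
        + (n * log ((1 - x₀) / (1 - y₀)) + n - n * ((1 - x₀) / (1 - y₀))) := by
    intro h
    rw [klTangent, Nat.cast_sub (hNn h)]
    ring
  have hint : Integrable (fun h => klTangent n x₀ y₀ (N h) (p h)) ρ := by
    simp_rw [hlin]
    exact ((hNi.const_mul _).add (hpi.const_mul _)).add (integrable_const _)
  have hval : ∫ h, klTangent n x₀ y₀ (N h) (p h) ∂ρ = n * bernKL x₀ y₀ := by
    simp_rw [hlin]
    have hint' : Integrable (fun h =>
        (log (x₀ / y₀) - log ((1 - x₀) / (1 - y₀))) * (N h : ℝ)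
          + (n * ((1 - x₀) / (1 - y₀)) - n * (x₀ / y₀)) * p h) ρ :=
      (hNi.const_mul _).add (hpi.const_mul _)
    rw [integral_add hint' (integrable_const _), integral_add (hNi.const_mul _) (hpi.const_mul _), integral_const_mul, integral_const_mul,
      hNx, hy₀, bernKL, ← mul_log_div_eq hy.1.ne',
      ← mul_log_div_eq (x := 1 - x₀) (y := 1 - y₀) (by linarith [hy.2])]
    have h1 : y₀ ≠ 0 := hy.1.ne'
    have h2 : 1 - y₀ ≠ 0 := by linarith [hy.2]
    simp only [integral_const, probReal_univ, smul_eq_mul, one_mul]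
    generalize log (x₀ / y₀) = L₁
    generalize log ((1 - x₀) / (1 - y₀)) = L₂
    field_simp
    ring
  rw [← hval]
  exact integral_le_klDiv_add_log hKL hint (measurable_expKL hN hp) hW hM hWM

/-- If the averaged bias is `0` or `1`, so is the bias of `ρ`-almost every `h`, and finiteness of the
exponential moment forces the empirical frequencies to agree with it, since `expKL` is infinite
wherever they differ. -/
lemma integral_eq_of_integral_eq_zero_or_one (hn : 0 < n) (hN : Measurable N)
    (hNn : ∀ h, N h ≤ n) (hp : Measurable p) (hp01 : ∀ h, p h ∈ Set.Icc (0 : ℝ) 1)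
    (hac : ρ ≪ π) (hW : ∫⁻ h, expKL n (N h) (p h) ∂π ≠ ∞)
    (hy : ∫ h, p h ∂ρ = 0 ∨ ∫ h, p h ∂ρ = 1) :
    ∫ h, (N h : ℝ) / n ∂ρ = ∫ h, p h ∂ρ := by
  have hn' : (n : ℝ) ≠ 0 := by exact_mod_cast hn.ne'
  have hfin : ∀ᵐ h ∂ρ, expKL n (N h) (p h) < ∞ :=
    hac.ae_le (ae_lt_top (measurable_expKL hN hp) hW)
  have htop : ∀ {k : ℕ} {y : ℝ}, k ≤ n → y ^ k * (1 - y) ^ (n - k) = 0 → expKL n k y = ∞ := by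
    intro k y hk h
    rw [expKL, h, ENNReal.ofReal_zero]
    exact ENNReal.div_zero (by simpa using maxLikelihood_pos hk)
  refine integral_congr_ae ?_
  rcases hy with hy | hy
  · filter_upwards [hfin, ae_eq_zero_of_integral_eq_zero hp hp01 hy] with h hf h0
    by_contra hne
    refine hf.ne (htop (hNn h) ?_)
    have : N h ≠ 0 := fun hN0 => hne (by simp [hN0, h0])
    simp [h0, this]
  · filter_upwards [hfin, ae_eq_one_of_integral_eq_one hp hp01 hy] with h hf h1
    by_contra hne
    refine hf.ne (htop (hNn h) ?_)
    have : n - N h ≠ 0 := fun hN0 => hne (by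
      rw [show N h = n from le_antisymm (hNn h) (by omega), h1, div_self hn'])
    simp [h1, this]

end

end SplitKL

end

/-! ### The upper inverse of the binary Kullback–Leibler divergence -/

noncomputable section

namespace SplitKL

open InformationTheory Filter Topology
open Real (log)

lemma bernoulliMeasure_singletons (t : unitInterval) :
    bernoulliMeasure true false t {true} = ENNReal.ofReal t ∧
      bernoulliMeasure true false t {false} = ENNReal.ofReal (1 - t) := by
  constructor
  · rw [← ofReal_measureReal, bernoulliMeasure_real_apply _ (measurableSet_singleton _)]
    simp
  · rw [← ofReal_measureReal, bernoulliMeasure_real_apply _ (measurableSet_singleton _)]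
    simp

lemma binKL_le_bernKL {x y : ℝ} (hx : x ∈ Set.Icc (0 : ℝ) 1) (hy : y ∈ Set.Icc (0 : ℝ) 1)
    (h0 : y = 0 → x = 0) (h1 : y = 1 → x = 1) : binKL x y ≤ ENNReal.ofReal (bernKL x y) := by
  rw [binKL, Set.projIcc_of_mem _ hx, Set.projIcc_of_mem _ hy]
  set μ := bernoulliMeasure true false (⟨x, hx⟩ : unitInterval) with hμ
  set ν := bernoulliMeasure true false (⟨y, hy⟩ : unitInterval) with hν
  obtain ⟨hμt, hμf⟩ := bernoulliMeasure_singletons ⟨x, hx⟩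
  obtain ⟨hνt, hνf⟩ := bernoulliMeasure_singletons ⟨y, hy⟩
  rw [← hμ] at hμt hμf
  rw [← hν] at hνt hνf
  simp only at hμt hμf hνt hνf
  have hac : μ ≪ ν := by
    intro s hs
    have key : ∀ a ∈ s, μ {a} = 0 := by
      intro a ha
      have hνa : ν {a} = 0 := measure_mono_null (Set.singleton_subset_iff.2 ha) hs
      cases a
      · rw [hνf, ENNReal.ofReal_eq_zero] at hνa
        rw [hμf, h1 (by linarith [hy.2])]
        simp
      · rw [hνt, ENNReal.ofReal_eq_zero] at hνa
        rw [hμt, h0 (by linarith [hy.1])]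
        simp
    rw [← Set.biUnion_of_singleton s]
    exact (measure_biUnion_null_iff s.toFinite.countable).2 key
  have hint : Integrable (llr μ ν) μ := .of_finite
  rw [klDiv_of_ac_of_integrable hac hint]
  refine ENNReal.ofReal_le_ofReal (le_of_eq ?_)
  have hrn : ∀ a, μ.rnDeriv ν a * ν {a} = μ {a} := by
    intro a
    rw [← lintegral_singleton, Measure.setLIntegral_rnDeriv hac]
  have hllr : ∀ {a : Bool} {u v : ℝ}, 0 ≤ u → 0 ≤ v → μ {a} = ENNReal.ofReal u →
      ν {a} = ENNReal.ofReal v → u * llr μ ν a = u * (log u - log v) := by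
    intro a u v hu hv hμa hνa
    rcases hu.eq_or_lt with rfl | hu
    · simp
    have h := hrn a
    rw [hμa, hνa] at h
    have h' := congrArg ENNReal.toReal h
    rw [ENNReal.toReal_mul, ENNReal.toReal_ofReal hv, ENNReal.toReal_ofReal hu.le] at h'
    have hv0 : v ≠ 0 := by
      rintro rfl
      rw [mul_zero] at h'
      exact hu.ne h'
    rw [llr, ← Real.log_div hu.ne' hv0, ← h', mul_div_cancel_right₀ _ hv0]
  rw [hμ, integral_bernoulliMeasure, ← hμ]
  simp only [probReal_univ, smul_eq_mul, add_sub_cancel_right]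
  rw [bernKL, hllr hx.1 hy.1 hμt hνt,
    hllr (by linarith [hx.2]) (by linarith [hy.2]) hμf hνf]

lemma continuousAt_bernKL {x y : ℝ} (h0 : y = 0 → x = 0) (h1 : y ≠ 1) :
    ContinuousAt (bernKL x) y := by
  have h1' : 1 - y ≠ 0 := fun h => h1 (by linarith)
  unfold bernKL
  rcases eq_or_ne x 0 with rfl | hx
  · simp only [zero_mul, zero_add]
    fun_prop (disch := assumption)
  · have hy : y ≠ 0 := fun h => hx (h0 h)
    fun_prop (disch := assumption)

lemma le_klInvUpper {x y : ℝ} {ε : ℝ≥0∞} (hy : y ∈ Set.Icc (0 : ℝ) 1) (h : binKL x y ≤ ε) :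
    y ≤ klInvUpper x ε :=
  le_csSup ⟨1, fun _ hp => hp.1.2⟩ ⟨hy, h⟩

lemma klInvUpper_le_one (x : ℝ) (ε : ℝ≥0∞) : klInvUpper x ε ≤ 1 :=
  Real.sSup_le (fun _ hp => hp.1.2) zero_le_one

/-- A strict bound on `kl(x‖y)` makes `y` strictly smaller than the upper inverse, because
`kl(x‖·)` is continuous from the right at `y`. -/
lemma lt_klInvUpper {x y c : ℝ} (hx : x ∈ Set.Icc (0 : ℝ) 1) (hy : y ∈ Set.Ico (0 : ℝ) 1)
    (h0 : y = 0 → x = 0) (hc : bernKL x y < c) : y < klInvUpper x (ENNReal.ofReal c) := by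
  have hev : ∀ᶠ z in 𝓝[>] y, bernKL x z < c :=
    ((continuousAt_bernKL h0 hy.2.ne).eventually_lt continuousAt_const hc).filter_mono
      nhdsWithin_le_nhds
  obtain ⟨z, hz, hyz, hz1⟩ := (hev.and (Ioo_mem_nhdsGT hy.2)).exists
  have hz01 : z ∈ Set.Icc (0 : ℝ) 1 := ⟨hy.1.trans hyz.le, hz1.le⟩
  refine hyz.trans_le (le_klInvUpper hz01 ?_)
  exact (binKL_le_bernKL hx hz01 (fun h => absurd h (hy.1.trans_lt hyz).ne')
    fun h => absurd h hz1.ne).trans (ENNReal.ofReal_le_ofReal hz.le)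

section

variable {H : Type*} [MeasurableSpace H] {ρ π : Measure H} [IsProbabilityMeasure ρ]
  [IsProbabilityMeasure π] {n : ℕ} {N : H → ℕ} {p : H → ℝ}

/-- The deterministic part of the PAC-Bayes-kl bound for one binary loss: it holds, for every
posterior `ρ` at once, wherever the exponential moment is below its threshold `T`. -/
lemma integral_lt_klInvUpper (hn : 0 < n) (hN : Measurable N) (hNn : ∀ h, N h ≤ n)
    (hp : Measurable p) (hp01 : ∀ h, p h ∈ Set.Icc (0 : ℝ) 1) {T : ℝ} (hT : 1 < T)
    (hW : ∫⁻ h, expKL n (N h) (p h) ∂π < ENNReal.ofReal T) :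
    ∫ h, p h ∂ρ < klInvUpper (∫ h, (N h : ℝ) / n ∂ρ)
        ((klDiv ρ π + ENNReal.ofReal (log T)) / (n : ℝ≥0∞)) ∨
      (∫ h, p h ∂ρ = 1 ∧ klInvUpper (∫ h, (N h : ℝ) / n ∂ρ)
        ((klDiv ρ π + ENNReal.ofReal (log T)) / (n : ℝ≥0∞)) = 1) := by
  have hn' : (0 : ℝ) < n := by exact_mod_cast hn
  have hT0 : 0 < T := one_pos.trans hT
  have hlogT : 0 < log T := Real.log_pos hT
  have hy01 := integral_mem_Icc (ρ := ρ) hp hp01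
  have hx01 := integral_mem_Icc (ρ := ρ) (p := fun h => (N h : ℝ) / n)
    ((measurable_from_top (f := fun k : ℕ => (k : ℝ) / n)).comp hN) (div_mem_Icc hn hNn)
  have hone : ∀ {x : ℝ} {ε : ℝ≥0∞}, binKL x 1 ≤ ε → klInvUpper x ε = 1 := fun h =>
    le_antisymm (klInvUpper_le_one _ _) (le_klInvUpper (Set.right_mem_Icc.2 zero_le_one) h)
  by_cases hKL : klDiv ρ π = ∞
  · have htop : (klDiv ρ π + ENNReal.ofReal (log T)) / (n : ℝ≥0∞) = ∞ := by
      rw [hKL, top_add, ENNReal.top_div_of_ne_top (ENNReal.natCast_ne_top n)]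
    rw [htop, hone le_top]
    exact hy01.2.lt_or_eq.imp_right fun h => ⟨h, rfl⟩
  have hε : (klDiv ρ π + ENNReal.ofReal (log T)) / (n : ℝ≥0∞)
      = ENNReal.ofReal (((klDiv ρ π).toReal + log T) / n) := by
    rw [ENNReal.ofReal_div_of_pos hn', ENNReal.ofReal_add ENNReal.toReal_nonneg hlogT.le,
      ENNReal.ofReal_toReal hKL, ENNReal.ofReal_natCast]
  have hc : 0 < ((klDiv ρ π).toReal + log T) / n := by
    have : 0 ≤ (klDiv ρ π).toReal := ENNReal.toReal_nonneg
    positivity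
  have hdeg := integral_eq_of_integral_eq_zero_or_one (ρ := ρ) hn hN hNn hp hp01
    (klDiv_ne_top_iff.1 hKL).1 (hW.trans ENNReal.ofReal_lt_top).ne
  rw [hε]
  rcases hy01.2.eq_or_lt with hy1 | hy1
  · right
    refine ⟨hy1, hone ?_⟩
    rw [hdeg (Or.inr hy1), hy1]
    simp [binKL]
  left
  rcases hy01.1.eq_or_lt with hy0 | hy0
  · refine lt_klInvUpper hx01 ⟨hy01.1, hy1⟩ (fun h => (hdeg (Or.inl h)).trans h) ?_
    rw [hdeg (Or.inl hy0.symm), ← hy0]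
    simpa [bernKL] using hc
  · refine lt_klInvUpper hx01 ⟨hy01.1, hy1⟩ (fun h => absurd h hy0.ne') ?_
    rw [lt_div_iff₀ hn', mul_comm]
    -- A positive real strictly below `T` that still bounds the exponential moment.
    set M := max (∫⁻ h, expKL n (N h) (p h) ∂π).toReal (T / 2)
    have hM0 : 0 < M := lt_max_of_lt_right (by positivity)
    have hMT : M < T := max_lt ((ENNReal.lt_ofReal_iff_toReal_lt
      (hW.trans ENNReal.ofReal_lt_top).ne).1 hW) (by linarith)
    have hWM : ∫⁻ h, expKL n (N h) (p h) ∂π ≤ ENNReal.ofReal M := by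
      rw [← ENNReal.ofReal_toReal (hW.trans ENNReal.ofReal_lt_top).ne]
      exact ENNReal.ofReal_le_ofReal (le_max_left _ _)
    calc n * bernKL (∫ h, (N h : ℝ) / n ∂ρ) (∫ h, p h ∂ρ)
        ≤ (klDiv ρ π).toReal + log M :=
          mul_bernKL_le_klDiv_add_log hn hN hNn hp hp01 hKL hM0 hWM ⟨hy0, hy1⟩
      _ < (klDiv ρ π).toReal + log T := by
          gcongr

end

end SplitKL

end

/-! ### The PAC-Bayes-split-kl inequality -/

noncomputable section

namespace SplitKL

open InformationTheory
open Real (log)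

section

variable {Ω H 𝒵 : Type*} [MeasurableSpace Ω] [MeasurableSpace H] [MeasurableSpace 𝒵] {K n : ℕ}

/-- Markov's inequality for the exponential moments of `K` binary losses, with a union bound. -/
lemma measure_iUnion_lintegral_expKL_ge_le {P : Measure Ω} [IsProbabilityMeasure P]
    (D : Measure 𝒵) [IsProbabilityMeasure D] (hK : 0 < K) (hn : 0 < n) {Z : Fin n → Ω → 𝒵}
    (hZ : ∀ i, Measurable (Z i)) (hlaw : ∀ i, P.map (Z i) = D) (hindep : iIndepFun Z P)
    (π : Kernel Ω H) [IsMarkovKernel π] (hπ : IndepFun (fun ω => π ω) (fun ω i => Z i ω) P)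
    {δ : ℝ} (hδ0 : 0 < δ) {A : Fin K → Set (H × 𝒵)} (hA : ∀ j, MeasurableSet (A j)) :
    P (⋃ j, {ω | ENNReal.ofReal (2 * K * √(n : ℝ) / δ)
      ≤ ∫⁻ h, expKL n (hits (Prod.mk h ⁻¹' A j) fun i => Z i ω) (D.real (Prod.mk h ⁻¹' A j))
        ∂(π ω)}) ≤ ENNReal.ofReal δ := by
  have hn' : (0 : ℝ) < n := by exact_mod_cast hn
  have hK' : (0 : ℝ) < K := by exact_mod_cast hK
  have hT : 0 < 2 * (K : ℝ) * √(n : ℝ) / δ := by positivity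
  have hmeas : ∀ j, Measurable fun ω => ∫⁻ h, expKL n (hits (Prod.mk h ⁻¹' A j) fun i => Z i ω)
      (D.real (Prod.mk h ⁻¹' A j)) ∂(π ω) := by
    intro j
    have hg : Measurable fun x : Ω × H => expKL n (hits (Prod.mk x.2 ⁻¹' A j) fun i => Z i x.1)
        (D.real (Prod.mk x.2 ⁻¹' A j)) := by
      refine measurable_expKL ?_ ?_
      · have hs : Measurable fun x : Ω × H => (x.2, fun i => Z i x.1) := by fun_prop
        exact (measurable_hits_section (hA j)).comp hs
      · exact (measurable_measureReal_section D (hA j)).comp measurable_snd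
    exact hg.lintegral_kernel_prod_right'
  refine (measure_iUnion_fintype_le _ _).trans ?_
  calc _ ≤ ∑ _j : Fin K, ENNReal.ofReal (δ / K) := by
        refine Finset.sum_le_sum fun j _ => ?_
        refine (meas_ge_le_lintegral_div (hmeas j).aemeasurable (by simpa using hT)
          ENNReal.ofReal_ne_top).trans ?_
        refine (ENNReal.div_le_div_right
          (lintegral_lintegral_expKL_le D hn hZ hlaw hindep π hπ (hA j)) _).trans_eq ?_
        rw [← ENNReal.ofReal_div_of_pos hT]
        congr 1
        have : √(n : ℝ) ≠ 0 := (Real.sqrt_pos.2 hn').ne'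
        field_simp
    _ = ENNReal.ofReal δ := by
        rw [Finset.sum_const, Finset.card_univ, Fintype.card_fin, nsmul_eq_mul,
          ← ENNReal.ofReal_natCast K, ← ENNReal.ofReal_mul hK'.le, mul_div_cancel₀ _ hK'.ne']

end

section

variable {H 𝒵 : Type*} {K n : ℕ} {b : Fin (K + 1) → ℝ} {f : H → 𝒵 → ℝ}

/-- Summing the widths up to the index `i` telescopes to `b i`. -/
lemma add_sum_width_mul_ite (b : Fin (K + 1) → ℝ) (i : Fin (K + 1)) :
    b 0 + ∑ j : Fin K, width b j * (if j.succ ≤ i then 1 else 0) = b i := by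
  simp only [width]
  induction K with
  | zero =>
    obtain rfl : i = 0 := Fin.fin_one_eq_zero i
    simp
  | succ K ih =>
    rw [Fin.sum_univ_castSucc]
    induction i using Fin.lastCases with
    | last =>
      have h := ih (fun i => b i.castSucc) (Fin.last K)
      simp only [Fin.le_last, if_true, Fin.succ_last, mul_one] at h ⊢
      simp only [Fin.castSucc_zero, ← Fin.succ_castSucc] at h ⊢
      linarith
    | cast i =>
      have h := ih (fun i => b i.castSucc) i
      simp only [Fin.castSucc_zero, ← Fin.succ_castSucc] at h
      simpa [← Fin.succ_castSucc, Fin.succ_last, Fin.castSucc_lt_iff_succ_le] using h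

lemma eq_add_sum_width_mul_component (hb : StrictMono b) (hfb : ∀ h z, f h z ∈ Set.range b)
    (h : H) (z : 𝒵) : f h z = b 0 + ∑ j : Fin K, width b j * component b f j h z := by
  obtain ⟨i, hi⟩ := hfb h z
  simp only [component, ← hi, hb.le_iff_le]
  exact (add_sum_width_mul_ite b i).symm

lemma sum_width (b : Fin (K + 1) → ℝ) : b 0 + ∑ j : Fin K, width b j = b (Fin.last K) := by
  simpa [Fin.le_last] using add_sum_width_mul_ite b (Fin.last K)

lemma width_pos (hb : StrictMono b) (j : Fin K) : 0 < width b j :=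
  sub_pos.2 (hb (Fin.castSucc_lt_succ))

/-- The graph of the event `f(h, z) ≥ b_j`. -/
def levelSet (b : Fin (K + 1) → ℝ) (f : H → 𝒵 → ℝ) (j : Fin K) : Set (H × 𝒵) :=
  {x | b j.succ ≤ f x.1 x.2}

lemma empiricalLoss_component (b : Fin (K + 1) → ℝ) (f : H → 𝒵 → ℝ) (j : Fin K)
    (s : Fin n → 𝒵) (h : H) :
    empiricalLoss (component b f j) s h = (hits (Prod.mk h ⁻¹' levelSet b f j) s : ℝ) / n := by
  classical
  simp only [empiricalLoss, component, hits, levelSet, Finset.sum_boole]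
  rw [one_div, div_eq_inv_mul]
  congr!

variable [MeasurableSpace H] [MeasurableSpace 𝒵]

lemma measurableSet_levelSet (hf : Measurable (Function.uncurry f)) (j : Fin K) :
    MeasurableSet (levelSet b f j) :=
  measurableSet_le measurable_const hf

lemma expectedLoss_eq (hb : StrictMono b) (hf : Measurable (Function.uncurry f))
    (hfb : ∀ h z, f h z ∈ Set.range b) (D : Measure 𝒵) [IsProbabilityMeasure D] (h : H) :
    expectedLoss D f h
      = b 0 + ∑ j : Fin K, width b j * D.real (Prod.mk h ⁻¹' levelSet b f j) := by
  have hA : ∀ j, MeasurableSet (Prod.mk h ⁻¹' levelSet b f j) := fun j =>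
    measurable_prodMk_left (measurableSet_levelSet hf j)
  have hcomp : ∀ j z, component b f j h z
      = (Prod.mk h ⁻¹' levelSet b f j).indicator (fun _ => (1 : ℝ)) z := by
    intro j z
    simp [component, Set.indicator_apply, levelSet]
  have hi : ∀ j, Integrable (fun z => width b j * component b f j h z) D := by
    intro j
    simp_rw [hcomp]
    exact ((integrable_const _).indicator (hA j)).const_mul _
  rw [expectedLoss]
  simp_rw [eq_add_sum_width_mul_component hb hfb h]
  rw [integral_add (integrable_const _) (integrable_finsetSum _ fun j _ => hi j),
    integral_finsetSum _ fun j _ => hi j]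
  simp_rw [integral_const_mul, hcomp, integral_indicator_const _ (hA _)]
  simp

/-- On the event that every exponential moment is below its threshold, the split bound holds for
every posterior, strictly unless both sides are the maximal loss. -/
lemma integral_expectedLoss_lt_or_eq (hK : 0 < K) (hb : StrictMono b)
    (hf : Measurable (Function.uncurry f)) (hfb : ∀ h z, f h z ∈ Set.range b) (D : Measure 𝒵)
    [IsProbabilityMeasure D] (hn : 0 < n) {δ : ℝ} (hδ0 : 0 < δ) (hδ1 : δ < 1) (π ρ : Measure H)
    [IsProbabilityMeasure π] [IsProbabilityMeasure ρ] (s : Fin n → 𝒵)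
    (hW : ∀ j, ∫⁻ h, expKL n (hits (Prod.mk h ⁻¹' levelSet b f j) s)
      (D.real (Prod.mk h ⁻¹' levelSet b f j)) ∂π < ENNReal.ofReal (2 * K * √(n : ℝ) / δ)) :
    ∫ h, expectedLoss D f h ∂ρ < splitKLBound b f δ π ρ s ∨
      (∫ h, expectedLoss D f h ∂ρ = b (Fin.last K) ∧
        splitKLBound b f δ π ρ s = b (Fin.last K)) := by
  have hT : 1 < 2 * (K : ℝ) * √(n : ℝ) / δ := by
    have h1 : (1 : ℝ) ≤ K := by exact_mod_cast hK
    have h2 : (1 : ℝ) ≤ √(n : ℝ) := Real.one_le_sqrt.2 (by exact_mod_cast hn)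
    rw [one_lt_div hδ0]
    nlinarith
  have hp : ∀ j, Measurable fun h => D.real (Prod.mk h ⁻¹' levelSet b f j) := fun j =>
    measurable_measureReal_section D (measurableSet_levelSet hf j)
  have hp01 : ∀ j h, D.real (Prod.mk h ⁻¹' levelSet b f j) ∈ Set.Icc (0 : ℝ) 1 := fun j h =>
    ⟨measureReal_nonneg, measureReal_le_one⟩
  have hF : ∫ h, expectedLoss D f h ∂ρ = b 0 + ∑ j : Fin K, width b j
      * ∫ h, D.real (Prod.mk h ⁻¹' levelSet b f j) ∂ρ := by
    have hi : ∀ j, Integrable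
        (fun h => width b j * D.real (Prod.mk h ⁻¹' levelSet b f j)) ρ := fun j =>
      (integrable_of_mem_Icc (hp j) (hp01 j)).const_mul _
    simp_rw [expectedLoss_eq hb hf hfb D]
    rw [integral_add (integrable_const _) (integrable_finsetSum _ fun j _ => hi j),
      integral_finsetSum _ fun j _ => hi j]
    simp_rw [integral_const_mul]
    simp
  have key := fun j => integral_lt_klInvUpper (ρ := ρ) hn
    ((measurable_hits_section (measurableSet_levelSet hf j)).comp
      (measurable_id.prodMk measurable_const)) (fun h => hits_le _ s) (hp j) (hp01 j) hT (hW j)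
  rw [hF, splitKLBound]
  simp only [empiricalLoss_component]
  simp only [Function.comp_apply, id] at key
  by_cases hall : ∀ j, ∫ h, D.real (Prod.mk h ⁻¹' levelSet b f j) ∂ρ = 1 ∧
      klInvUpper (∫ h, (hits (Prod.mk h ⁻¹' levelSet b f j) s : ℝ) / n ∂ρ)
        ((klDiv ρ π + ENNReal.ofReal (log (2 * K * √(n : ℝ) / δ))) / (n : ℝ≥0∞)) = 1
  · right
    simp only [(hall _).1, (hall _).2, mul_one, sum_width, and_self]
  · left
    push Not at hall
    obtain ⟨j, hj⟩ := hall
    gcongr 1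
    refine Finset.sum_lt_sum (fun i _ => ?_) ⟨j, Finset.mem_univ j, ?_⟩
    · refine mul_le_mul_of_nonneg_left ?_ (width_pos hb i).le
      rcases key i with h | h
      · exact h.le
      · exact h.1.trans_le h.2.ge
    · refine mul_lt_mul_of_pos_left ?_ (width_pos hb j)
      exact (key j).resolve_right fun h => hj h.1 h.2

end

end SplitKL

end

theorem mainTheorem2
    {Ω H 𝒵 : Type*} [MeasurableSpace Ω] [MeasurableSpace H] [MeasurableSpace 𝒵]
    -- the values `b_0 < ⋯ < b_K` and the loss
    (K : ℕ) (hK : 0 < K) (b : Fin (K + 1) → ℝ) (hb : StrictMono b)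
    (f : H → 𝒵 → ℝ) (hf : Measurable (Function.uncurry f))
    (hfb : ∀ h z, f h z ∈ Set.range b)
    -- the i.i.d. sample `S = (Z_1, …, Z_n)` from `D`
    (P : Measure Ω) [IsProbabilityMeasure P] (D : Measure 𝒵) [IsProbabilityMeasure D]
    (n : ℕ) (hn : 0 < n) (Z : Fin n → Ω → 𝒵) (hZ : ∀ i, Measurable (Z i))
    (hlaw : ∀ i, P.map (Z i) = D) (hindep : iIndepFun Z P)
    -- the prior, possibly random, independent of `S`
    (π : Kernel Ω H) [IsMarkovKernel π]
    (hπ : IndepFun (fun ω => π ω) (fun ω i => Z i ω) P)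
    (δ : ℝ) (hδ0 : 0 < δ) (hδ1 : δ < 1) :
    (∀ h z, f h z = b 0 + ∑ j : Fin K, SplitKL.width b j * SplitKL.component b f j h z) ∧
    -- outer probability of the failure event; equality at the maximal loss `b_K` is no failure
    P {ω | ∃ ρ : Measure H, IsProbabilityMeasure ρ ∧
        SplitKL.splitKLBound b f δ (π ω) ρ (fun i => Z i ω)
          ≤ ∫ h, SplitKL.expectedLoss D f h ∂ρ ∧
        ¬ (∫ h, SplitKL.expectedLoss D f h ∂ρ = b (Fin.last K) ∧
            SplitKL.splitKLBound b f δ (π ω) ρ (fun i => Z i ω) = b (Fin.last K))}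
      ≤ ENNReal.ofReal δ := by
  refine ⟨SplitKL.eq_add_sum_width_mul_component hb hfb, le_trans (measure_mono ?_)
    (SplitKL.measure_iUnion_lintegral_expKL_ge_le D hK hn hZ hlaw hindep π hπ hδ0
      (SplitKL.measurableSet_levelSet (b := b) hf))⟩
  rintro ω ⟨ρ, hρ, hle, hne⟩
  by_contra hω
  simp only [Set.mem_iUnion, Set.mem_ofPred_eq, not_exists, not_le] at hω
  rcases SplitKL.integral_expectedLoss_lt_or_eq hK hb hf hfb D hn hδ0 hδ1 (π ω) ρ
    (fun i => Z i ω) hω with h | h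
  · exact hle.not_gt h
  · exact hne h
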